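/- Let $\mathbb{T}$ be a finite limit theory with (small, finitely complete) syntactic category $\mathcal{C}$, and let $\mathbb{T}[\mathcal{S}]=\mathrm{Lex}[\mathcal{C},\mathbf{Set}]$ be its category of set-valued models, in which $c\in\mathcal{C}$ is identified with the corepresentable model $K_c=\mathcal{C}(c,-)$, so that an arrow $d\to c$ of $\mathcal{C}$ has a dual $K_c\to K_d$. Let $(\mathbb{T},\mathcal{V},J)$ be a geometry, i.e. - $\mathcal{V}$ is a saturated class: a class of maps between finitely presented objects of $\mathbb{T}[\mathcal{S}]$ that contains all isomorphisms between such objects, is closed under composition, under pushouts along maps between finitely presented objects and under finite colimits in the arrow category of $\mathbb{T}[\mathcal{S}]$, and is right-cancellative ($f\in\mathcal{V}$ and $gf\in\mathcal{V}$ imply $g\in\mathcal{V}$); - $J$ is a Grothendieck topology on $\mathcal{C}$ generated by families of arrows whose duals lie in $\mathcal{V}$. A model $A$ is *$J$-local* (equivalently, a model of the geometric extension $\mathbb{T}_J$ in $\mathbf{Set}$) if for the dual $(K\to K_i)_{i\in I}$ of any $J$-covering family, each map $K\to A$ factors through $K\to K_i$ for some $i\in I$. For a model $B$ let $\mathcal{V}_B$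 be the full subcategory of the coslice $B\downarrow\mathbb{T}[\mathcal{S}]$ on the maps $n:B\to D$ that are a pushout of some $K\to K'$ in $\mathcal{V}$ along some map $K\to B$. Let $J_B$ be the Grothendieck topology on $\mathcal{V}_B^{\mathrm{op}}$ generated by the duals of the families $(m_i:n\to n_i)_{i\in I}$ in $\mathcal{V}_B$, with $m_i:D\to D_i$ on codomains, for which there are a map $b:K\to D$ and the dual $(K\to K_i)_{i\in I}$ of a $J$-covering family such that each $m_i$ is the pushout of $K\to K_i$ along $b$. Put $\mathrm{Spec}(B)=\mathrm{Sh}(\mathcal{V}_B^{\mathrm{op}},J_B)$. **Proposition.** If $A$ is a $J$-local object of $\mathbb{T}[\mathcal{S}]$, then $\mathrm{Spec}(A)$ is a local topos: it is a Grothendieck topos, and the geometric morphism $\mathrm{Spec}(A)\to\mathbf{Set}$ is local, i.e. its inverse image functor is full and faithful and its direct image functor, the global section functor, has a further right adjoint. -/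

import Mathlib

open CategoryTheory CategoryTheory.Limits Opposite

universe u v w

namespace SpectralGeometry

section Toposes

/-- A Grothendieck topos: a category equivalent to the category of sheaves of (`u`-small) sets on
a `u`-small site. -/
def IsGrothendieckTopos (E : Type v) [Category.{w} E] : Prop :=
  ∃ (S : Type u) (_ : SmallCategory S) (J : GrothendieckTopology S),
    Nonempty (E ≌ Sheaf J (Type u))

/-- A geometric morphism `F ⟶ E`: an adjunction `f^* ⊣ f_*` whose left adjoint `f^* : E ⥤ F`
preserves finite limits. -/
structure GeometricMorphism (F : Type*) [Category F] (E : Type*) [Category E] where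
  /-- the inverse image functor `f^*` -/
  inverseImage : E ⥤ F
  /-- the direct image functor `f_*` -/
  directImage : F ⥤ E
  /-- the adjunction `f^* ⊣ f_*` -/
  adj : inverseImage ⊣ directImage
  /-- the inverse image functor preserves finite limits -/
  lex : PreservesFiniteLimits inverseImage

/-- A geometric morphism `f` is local if `f^*` is full and faithful and `f_*` has a further right
adjoint. -/
structure GeometricMorphism.IsLocal {F : Type*} [Category F] {E : Type*} [Category E]
    (f : GeometricMorphism F E) : Prop where
  full : f.inverseImage.Full
  faithful : f.inverseImage.Faithful
  isLeftAdjoint : f.directImage.IsLeftAdjoint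

/-- A local topos: a Grothendieck topos `E` whose geometric morphism to the topos of sets (the one
whose direct image is the global section functor; it is unique up to isomorphism) is local. -/
def IsLocalTopos (E : Type v) [Category.{w} E] : Prop :=
  IsGrothendieckTopos.{u} E ∧ ∃ f : GeometricMorphism E (Type u), f.IsLocal

end Toposes

section Models

variable (C : Type u) [SmallCategory C]

/-- The category `𝕋[Set]` of set-valued models of the finite limit theory `𝕋` with syntactic
category `C`: finite-limit-preserving functors from `C` to sets, and natural transformations. -/
abbrev Model := C ⥤ₗ Type u

/-- The dual `Cᵒᵖ ⥤ 𝕋[Set]` of the syntactic category: it sends `c` to the corepresentable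
model `C(c, -)`. -/
def corep : Cᵒᵖ ⥤ Model C :=
  ObjectProperty.lift _ coyoneda fun c =>
    (inferInstance : PreservesFiniteLimits (coyoneda.obj c))

variable {C}

/-- A saturated class of maps of finite presentation in `𝕋[Set]`. -/
structure IsSaturatedClass (V : MorphismProperty (Model C)) : Prop where
  /-- every map in the class is a map between finitely presented objects -/
  fp : ∀ ⦃K L : Model C⦄ (f : K ⟶ L), V f →
    IsFinitelyPresentable.{u} K ∧ IsFinitelyPresentable.{u} L
  /-- closure under composition -/
  comp : ∀ ⦃K L M : Model C⦄ (f : K ⟶ L) (g : L ⟶ M), V f → V g → V (f ≫ g)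
  /-- all isomorphisms (between finitely presented objects) are in the class -/
  iso : ∀ ⦃K L : Model C⦄ (f : K ⟶ L), IsIso f →
    IsFinitelyPresentable.{u} K → IsFinitelyPresentable.{u} L → V f
  /-- right cancellation -/
  cancel : ∀ ⦃K L M : Model C⦄ (f : K ⟶ L) (g : L ⟶ M), V f → V (f ≫ g) → V g
  /-- closure under pushouts along maps between finitely presented objects -/
  pushout : ∀ ⦃K L K' L' : Model C⦄ (f : K ⟶ L) (a : K ⟶ K') (f' : K' ⟶ L') (b : L ⟶ L'),
    V f → IsFinitelyPresentable.{u} K' → IsPushout a f f' b → V f'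
  /-- closure under finite colimits in the category of arrows of `𝕋[Set]` -/
  colimit : ∀ (I : Type) [SmallCategory I] [FinCategory I] (D : I ⥤ Arrow (Model C))
    (c : Cocone D), IsColimit c → (∀ i, V (D.obj i).hom) → V c.pt.hom

end Models

/-- A geometry `(𝕋, 𝒱, J)` on the finite limit theory `𝕋` with syntactic category `C`: a saturated
class `𝒱` in `𝕋[Set]`, and a Grothendieck topology `J` on `C` generated by families of arrows
whose duals in `𝕋[Set]` belong to `𝒱`. -/
structure Geometry (C : Type u) [SmallCategory C] where
  /-- the saturated class `𝒱` -/
  V : MorphismProperty (Model C)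
  saturated : IsSaturatedClass V
  /-- the Grothendieck topology `J` -/
  J : GrothendieckTopology C
  generated : ∃ P : Precoverage C,
    (∀ (c : C), ∀ R ∈ P c, ∀ (d : C) (f : d ⟶ c), R f → V ((corep C).map f.op)) ∧
      P.toGrothendieck = J

namespace Geometry

variable {C : Type u} [SmallCategory C] (G : Geometry C)

/-- `J`-local objects of `𝕋[Set]` (equivalently, models of the geometric extension `𝕋_J`): for the
dual `(K ⟶ K i)` of any `J`-covering family, every map `K ⟶ A` factors through some `K ⟶ K i`. -/
def IsLocalObject (A : Model C) : Prop :=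
  ∀ (c : C) (I : Type u) (d : I → C) (l : ∀ i, d i ⟶ c), Sieve.ofArrows d l ∈ G.J c →
    ∀ f : (corep C).obj (op c) ⟶ A,
      ∃ (i : I) (g : (corep C).obj (op (d i)) ⟶ A), (corep C).map (l i).op ≫ g = f

/-- The etale generator `𝒱_B`: the full subcategory of the category of objects under `B` on the
maps `n : B ⟶ D` that are pushouts, along some `K ⟶ B`, of some `K ⟶ K'` in `𝒱`. -/
abbrev EtaleGenerator (B : Model C) :=
  ObjectProperty.FullSubcategory fun n : Under B => G.V.pushouts n.hom

/-- The families that generate the spectral topology on `𝒱_Bᵒᵖ`: the duals of the families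
`(m i : n ⟶ n' i)` of maps of `𝒱_B` that, as maps `D ⟶ D' i` between the codomains,
are the pushouts along one map `b : K ⟶ D` of the dual `(K ⟶ K i)` of a `J`-covering family. -/
def spectralPrecoverage (B : Model C) : Precoverage (G.EtaleGenerator B)ᵒᵖ where
  coverings n := {R | ∃ (c : C) (I : Type u) (d : I → C) (l : ∀ i, d i ⟶ c)
    (_ : Sieve.ofArrows d l ∈ G.J c)
    (b : (corep C).obj (op c) ⟶ n.unop.obj.right)
    (n' : I → G.EtaleGenerator B) (m : ∀ i, n.unop ⟶ n' i)
    (k : ∀ i, (corep C).obj (op (d i)) ⟶ (n' i).obj.right),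
    (∀ i, IsPushout b ((corep C).map (l i).op) (m i).hom.right (k i)) ∧
      R = Presieve.ofArrows (fun i => op (n' i)) (fun i => (m i).op)}

/-- The spectral topology `J_B` on `𝒱_Bᵒᵖ`. -/
def spectralTopology (B : Model C) : GrothendieckTopology (G.EtaleGenerator B)ᵒᵖ :=
  (G.spectralPrecoverage B).toGrothendieck

/-- The spectrum `Spec B = Sh(𝒱_Bᵒᵖ, J_B)`. -/
abbrev Spec (B : Model C) := Sheaf (G.spectralTopology B) (Type u)

end Geometry

end SpectralGeometry

/-!
The identity of `A` is the terminal object of the site `𝒱_Aᵒᵖ` of `Spec A`. If `A` is `J`-local, it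
has only the trivial cover: an arrow from it to `n : A ⟶ D` is a retraction `r` of `n`, and for the
pushouts `D ⟶ D i` of a dual covering family `(K ⟶ K i)` the composite `K ⟶ D ⟶ A` factors through
some `K i`, so that `r` extends along `D ⟶ D i`. Hence the site is local, and sheaves on a local
site form a local topos.

The site is essentially small because every model is a filtered colimit of corepresentable ones:
finitely presentable models are thus retracts of corepresentable models.
-/

namespace SpectralGeometry

section Density

lemma isDense_of_isDense_comp {I : Type*} [Category* I] {D : Type*} [Category* D]
    {E : Type*} [Category* E] (F : I ⥤ D) (U : D ⥤ E) [U.Full] [U.Faithful] [(F ⋙ U).IsDense] :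
    F.IsDense where
  isDenseAt X :=
    ⟨isColimitOfReflects U <| .ofIsoColimit
      (((F ⋙ U).denseAt (U.obj X)).whiskerEquivalence (CostructuredArrow.post F U X).asEquivalence)
      (Cocone.ext (Iso.refl _) fun j => (Category.comp_id _).trans <|
        (Category.id_comp _).trans (congrArg U.map (Category.id_comp j.hom)).symm)⟩

instance isDense_coyoneda {D : Type v} [Category.{w} D] : (coyoneda (C := D)).IsDense :=
  .of_iso Coyoneda.opIso

lemma isFinitelyPresentable_le_retractClosure_of_isDense {I : Type*} [Category* I]
    [EssentiallySmall.{u} I] {D : Type v} [Category.{w} D] [LocallySmall.{u} D] (F : I ⥤ D)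
    [F.IsDense] [∀ X, IsFiltered (CostructuredArrow F X)] :
    ObjectProperty.isFinitelyPresentable.{u} D ≤ (ObjectProperty.ofObj F.obj).retractClosure := by
  intro X (hX : IsFinitelyPresentable.{u} X)
  let e := equivSmallModel.{u} (CostructuredArrow F X)
  have := IsFiltered.of_equivalence e
  obtain ⟨j, i, hi⟩ := IsFinitelyPresentable.exists_hom_of_isColimit
    ((F.denseAt X).whiskerEquivalence e.symm) (𝟙 X)
  exact ⟨_, ⟨(e.inverse.obj j).left⟩, ⟨⟨i, _, hi⟩⟩⟩

attribute [local instance] Cardinal.fact_isRegular_aleph0 in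
lemma isFinitelyPresentable_of_isInitial {D : Type v} [Category.{w} D] [LocallySmall.{u} D]
    {X : D} (hX : IsInitial X) : IsFinitelyPresentable.{u} X :=
  have (j : Discrete PEmpty.{1}) :
      IsCardinalPresentable ((Functor.empty D).obj j) Cardinal.aleph0.{u} := j.as.elim
  isCardinalPresentable_of_isColimit _ hX _ (hasCardinalLT_of_finite _ _ le_rfl)

end Density

section Models

variable (C : Type u) [SmallCategory C]

instance isDense_corep : (corep C).IsDense :=
  have : (corep C ⋙ ObjectProperty.ι _).IsDense := isDense_coyoneda
  isDense_of_isDense_comp (corep C) (ObjectProperty.ι _)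

variable {C} in
/-- The Yoneda lemma for corepresentable models: maps from the model corepresented by `c` to `M`
are the elements of `M` at `c`, naturally in `c`. -/
def corepHomIso (M : Model C) : (corep C).op ⋙ yoneda.obj M ≅ unopUnop C ⋙ M.obj :=
  NatIso.ofComponents
    (fun c => ((ObjectProperty.fullyFaithfulι _).homEquiv.trans coyonedaEquiv).toIso)
    (fun f => by ext x; exact (coyonedaEquiv_naturality x.hom f.unop.unop).symm)

instance preservesFiniteColimits_corep : PreservesFiniteColimits (corep C) where
  preservesFiniteColimits I _ _ := ⟨⟨fun {c} hc => ⟨by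
    refine ((corep C).mapCocone c).isColimitYonedaEquiv.symm fun M => ?_
    have : PreservesFiniteLimits M.obj := M.property
    have : PreservesLimitsOfShape Iᵒᵖ ((corep C).op ⋙ yoneda.obj M) :=
      preservesLimitsOfShape_of_natIso (corepHomIso M).symm
    exact isLimitOfPreserves ((corep C).op ⋙ yoneda.obj M) hc.op⟩⟩⟩

variable [HasFiniteLimits C]

instance isFiltered_costructuredArrow_corep (M : Model C) :
    IsFiltered (CostructuredArrow (corep C) M) :=
  (coflat_of_preservesFiniteColimits (corep C)).filtered M

instance essentiallySmall_isFinitelyPresentable :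
    ObjectProperty.EssentiallySmall.{u} (ObjectProperty.isFinitelyPresentable.{u} (Model C)) :=
  .of_le (isFinitelyPresentable_le_retractClosure_of_isDense (corep C))

end Models

section Coslice

lemma exists_comp_eq_of_right_comp_eq {D : Type*} [Category* D] {A : D}
    {P : ObjectProperty (Under A)} {X Y Z : P.FullSubcategory} (f : X ⟶ Y) (g : X ⟶ Z)
    {t : Y.obj.right ⟶ Z.obj.right} (ht : f.hom.right ≫ t = g.hom.right) : ∃ s, f ≫ s = g :=
  ⟨ObjectProperty.homMk (Under.homMk t
      (by rw [← Under.w f.hom, Category.assoc, ht, Under.w])),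
    ObjectProperty.hom_ext _ (Under.UnderMorphism.ext ht)⟩

variable {D : Type v} [Category.{w} D] [LocallySmall.{u} D]

lemma essentiallySmall_of_map_forget {A : D} (P : ObjectProperty (Under A))
    [ObjectProperty.EssentiallySmall.{u} (P.map (Under.forget A))] :
    ObjectProperty.EssentiallySmall.{u} P := by
  refine .of_functor P (Under.forget A) inferInstance fun X => ?_
  have le_isoClosure : P ⊓ (fun n => Nonempty ((Under.forget A).obj n ≅ X)) ≤
      (ObjectProperty.ofObj fun f : A ⟶ X => Under.mk f).isoClosure :=
    fun n ⟨_, ⟨e⟩⟩ => ⟨_, ⟨n.hom ≫ e.hom⟩, ⟨Under.isoMk e⟩⟩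
  exact .of_le le_isoClosure

lemma essentiallySmall_under_pushouts {W : MorphismProperty D} (P : ObjectProperty D)
    [ObjectProperty.EssentiallySmall.{u} P] (hW : ∀ ⦃K L : D⦄ (f : K ⟶ L), W f → P K ∧ P L)
    (A : D) : ObjectProperty.EssentiallySmall.{u} fun n : Under A => W.pushouts n.hom := by
  have map_forget_le : ObjectProperty.map (fun n : Under A => W.pushouts n.hom) (Under.forget A) ≤
      (P ⊔ .singleton A).colimitClosure WalkingSpan := by
    rintro X ⟨n, ⟨K, L, f, a, b, hf, h⟩, ⟨e⟩⟩
    obtain ⟨hK, hL⟩ := hW f hf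
    refine ObjectProperty.prop_of_iso _ e (ObjectProperty.prop_of_isColimit _ h.isColimit ?_)
    rintro (_ | _ | _)
    exacts [.of_mem _ (.inl hK), .of_mem _ (.inr ⟨⟨⟩⟩), .of_mem _ (.inl hL)]
  have := ObjectProperty.EssentiallySmall.of_le.{u} map_forget_le
  exact essentiallySmall_of_map_forget _

end Coslice

section Sites

lemma arrow_mem_of_mem_toGrothendieck {D : Type*} [Category* D] {K : Precoverage D} {T : D}
    (hK : ∀ ⦃X : D⦄, ∀ R ∈ K X, ∀ x : T ⟶ X, Sieve.generate R x) {X : D} {S : Sieve X}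
    (hS : S ∈ K.toGrothendieck X) (x : T ⟶ X) : S x := by
  induction hS with
  | of _ R hR => exact hK R hR x
  | top => trivial
  | pullback _ _ _ _ f ih => exact ih (x ≫ f)
  | transitive _ _ _ _ _ ihS ihR => simpa using ihR (ihS x) (𝟙 T)

lemma isLocalSite_toGrothendieck {D : Type*} [Category* D] {K : Precoverage D} {T : D}
    (hT : IsTerminal T) (hK : ∀ ⦃X : D⦄, ∀ R ∈ K X, ∀ x : T ⟶ X, Sieve.generate R x) :
    K.toGrothendieck.IsLocalSite :=
  have := hT.hasTerminal
  let e := terminalIsTerminal.uniqueUpToIso hT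
  { eq_top_of_mem S hS := by
      rw [← Sieve.id_mem_iff_eq_top, ← e.hom_inv_id]
      exact S.downward_closed (arrow_mem_of_mem_toGrothendieck hK hS e.inv) e.hom }

variable {D : Type w} [Category.{v} D] [EssentiallySmall.{u} D] (J : GrothendieckTopology D)

lemma isGrothendieckTopos_sheaf : IsGrothendieckTopos.{u} (Sheaf J (Type u)) :=
  ⟨_, _, _, ⟨(equivSmallModel.{u} D).sheafCongr J
    ((equivSmallModel.{u} D).inverse.inducedTopology J) (Type u)⟩⟩

open GrothendieckTopology in
lemma isLocalTopos_sheaf [J.IsLocalSite] : IsLocalTopos.{u} (Sheaf J (Type u)) := by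
  have := hasSheafifyEssentiallySmallSite J (Type u)
  have := locallySmall_of_essentiallySmall.{u} D
  let toSet : GeometricMorphism (Sheaf J (Type u)) (Type u) :=
    { inverseImage := constantSheaf J (Type u)
      directImage := Sheaf.Γ J (Type u)
      adj := constantSheafΓAdj J (Type u)
      lex := comp_preservesFiniteLimits _ _ }
  exact ⟨isGrothendieckTopos_sheaf J, toSet,
    { full := IsLocalSite.full_constantSheaf.{u} J (Type u)
      faithful := IsLocalSite.faithful_constantSheaf.{u} J (Type u)
      isLeftAdjoint := IsLocalSite.Γ_isLeftAdjoint.{u} J (Type u) }⟩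

end Sites

namespace Geometry

variable {C : Type u} [SmallCategory C] {G : Geometry C}

lemma IsLocalObject.exists_comp_eq_of_isPushout {A : Model C} (hA : G.IsLocalObject A) {c : C}
    {I : Type u} {d : I → C} {l : ∀ i, d i ⟶ c} (hl : Sieve.ofArrows d l ∈ G.J c) {D : Model C}
    {b : (corep C).obj (op c) ⟶ D} {D' : I → Model C} {m : ∀ i, D ⟶ D' i}
    {k : ∀ i, (corep C).obj (op (d i)) ⟶ D' i}
    (h : ∀ i, IsPushout b ((corep C).map (l i).op) (m i) (k i)) (r : D ⟶ A) :
    ∃ (i : I) (s : D' i ⟶ A), m i ≫ s = r := by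
  obtain ⟨i, g, hg⟩ := hA c I d l hl (b ≫ r)
  exact ⟨i, (h i).desc r g hg.symm, (h i).inl_desc _ _ _⟩

lemma generate_apply_of_mem_spectralPrecoverage {B : Model C} {T X : (G.EtaleGenerator B)ᵒᵖ}
    (hT : G.IsLocalObject T.unop.obj.right) {R : Presieve X} (hR : R ∈ G.spectralPrecoverage B X)
    (x : T ⟶ X) : Sieve.generate R x := by
  obtain ⟨c, I, d, l, hl, b, n, m, k, h, rfl⟩ := hR
  obtain ⟨i, t, ht⟩ := hT.exists_comp_eq_of_isPushout hl h x.unop.hom.right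
  obtain ⟨s, hs⟩ := exists_comp_eq_of_right_comp_eq (m i) x.unop ht
  exact ⟨_, s.op, _, ⟨i⟩, Quiver.Hom.unop_inj hs⟩

variable [HasFiniteLimits C]

variable (G) in
lemma pushouts_id (A : Model C) : G.V.pushouts (𝟙 A) := by
  let K := (corep C).obj (op (⊤_ C))
  have isInitial : IsInitial K := (initialOpOfTerminal terminalIsTerminal).isInitialObj (corep C)
  have hK := isFinitelyPresentable_of_isInitial.{u} isInitial
  have id_mem : G.V (𝟙 K) := G.saturated.iso _ inferInstance hK hK
  exact G.V.isomorphisms_le_pushouts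
    (fun X => ⟨K, K, 𝟙 K, id_mem, isInitial.to X, inferInstance⟩) _ (.infer_property _)

lemma isLocalSite_spectralTopology {A : Model C} (hA : G.IsLocalObject A) :
    (G.spectralTopology A).IsLocalSite :=
  isLocalSite_toGrothendieck (T := op ⟨Under.mk (𝟙 A), G.pushouts_id A⟩)
    (terminalOpOfInitial (IsInitial.isInitialOfObj (ObjectProperty.ι _) _ Under.mkIdInitial))
    fun _ _ => generate_apply_of_mem_spectralPrecoverage hA

instance essentiallySmall_etaleGenerator (A : Model C) :
    EssentiallySmall.{u} (G.EtaleGenerator A) :=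
  have := essentiallySmall_under_pushouts (ObjectProperty.isFinitelyPresentable.{u} (Model C))
    G.saturated.fp A
  inferInstance

end Geometry

end SpectralGeometry

theorem mainTheorem10 (C : Type u) [SmallCategory C] [HasFiniteLimits C]
    (G : SpectralGeometry.Geometry C) (A : SpectralGeometry.Model C) (hA : G.IsLocalObject A) :
    SpectralGeometry.IsLocalTopos.{u} (G.Spec A) :=
  have := SpectralGeometry.Geometry.isLocalSite_spectralTopology hA
  SpectralGeometry.isLocalTopos_sheaf (G.spectralTopology A)
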